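/- Logarithms are to base $2$. Let $n\ge 1$ and let $F$ be a discrete distribution over sequences $v=(v_1,\dots,v_n)\in\mathbb{R}_{\ge 0}^n$ (with arbitrary correlations) such that every $v$ in the support has a unique maximal entry; let $F^*$ be the distribution of $\max_i v_i$, $v\sim F$. An online algorithm that knows $F$ observes $k$ independent samples $v^{(1)},\dots,v^{(k)}$ of $F$ (rounds), block after block and, within a block, reward after reward, and may irrevocably accept one reward at its arrival; $\mathrm{ALG}(v)$ is the accepted reward, or $0$ if none is accepted. The $(1-\varepsilon)$-competition complexity of $\mathrm{ALG}$ is the smallest positive integer $k(n,\varepsilon)$ such that $\mathbb{E}_{v\sim F^k}[\mathrm{ALG}(v)]\ge(1-\varepsilon)\,\mathbb{E}_{v\sim F}[\max_i v_i]$ for every such $F$ and every $k\ge k(n,\varepsilon)$ (expectations may be infinite). A $q$-quantile threshold of a distribution $D$ is a real $T$ with $\Pr_D[X<T]\le q\le\Pr_D[X\le T]$. For a prefix $x=(x_1,\dots,x_i)$ let $\mathrm{PM}(x)=\Pr_{v\sim F}[x_i=\max_j v_j\mid v_{\le i}=x]$. Let $0<\varepsilon<1$ be such that $r=\lceil\log\log\frac1\varepsilon+\log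 n\rceil\ge 0$ (automatic if $\varepsilon\le\frac12$). Let $T_0$ be a $(1-\frac1n)$-quantile threshold of $F^*$, let $p=\Pr[\max_j v_j<T_0]$, and for $i\ge 1$ let $T_i$ be a $p^{2^i}$-quantile threshold of $F^*$; such thresholds exist, and any choice is allowed. The two-phase algorithm is the following. Phase 1 ($n+1$ rounds). In each round, upon the arrival of $v_i$, draw independent $Y_i\sim\mathrm{Ber}(\mathrm{PM}(v_{\le i}))$ and $Z_i\sim\mathrm{Ber}\bigl(1/(n-\sum_{j<i}\mathrm{PM}(v_{\le j}))\bigr)$. Call reward $i$ active if $Y_i=1$; it is selected if it is the first reward of the round with $Y_i=Z_i=1$. If the selected reward satisfies $v_i>T_0$, accept it; otherwise accept nothing in this round. Phase 2 ($r+2$ rounds). In its round $t=1,\dots,r+2$, accept the first reward with $v_i\ge T_{\max\{t-2,0\}}$. After phase 2 nothing is accepted. Then the following hold. (1) The selection rule of phase 1 is well defined and is an online contention resolution scheme with selectability exactly $\frac1n$: given the block $v$, reward $i$ is (active and) selected with probability $\frac1n\mathrm{PM}(v_{\le i})$, that is, $\frac1n$ times the probability that it is active. (2) The algorithm uses $n+r+3=n+\lceil\log\log\frac1\varepsilon+\log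 n\rceil+3$ rounds, and for every $k\ge n+r+3$ its value on $k$ copies stochastically dominates $F^*$ up to the $\varepsilon$-quantile: for every real $y$, $\Pr[\mathrm{ALG}(v)\ge y]\ge\Pr[\max_i v_i\ge y]$ or $\Pr[\max_i v_i<y]\le\varepsilon$. More precisely, $\Pr[\max_i v_i<T_r]\le\varepsilon$, and $\Pr[\mathrm{ALG}(v)\ge y]\ge\Pr[\max_i v_i\ge y]$ for every $y\ge T_r$. Its $(1-\varepsilon)$-competition complexity is at most $n+r+3$. (3) Its $(1-\varepsilon)$-competition complexity is at most $(1+o(1))\,(n+\log\log\frac1\varepsilon)$: for every $\delta>0$ there is $M$ such that for all $n\ge1$ and $0<\varepsilon<1$ with $r\ge0$ and $n+\log\log\frac1\varepsilon\ge M$, and for all choices of thresholds, it is at most $n+r+3\le(1+\delta)(n+\log\log\frac1\varepsilon)$. -/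

import Mathlib

open scoped NNReal ENNReal

noncomputable section

namespace CorrProphet

/-! ### Instances -/

/-- A correlated prophet instance with `n` rewards: a discrete distribution over sequences of `n`
nonnegative rewards (arbitrarily correlated), such that in every sequence of the support the
maximum is attained by exactly one reward.  (This forces `1 ≤ n`.) -/
structure Instance (n : ℕ) where
  /-- the joint distribution of the `n` rewards -/
  law : PMF (Fin n → ℝ≥0)
  /-- the maximum of every realization is attained exactly once -/
  unique_max : ∀ v ∈ law.support, ∃! j : Fin n, v j = Finset.univ.sup v

/-- The distribution of the prophet's value `max_i v_i`, `v ∼ F`. -/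
def Instance.maxLaw {n : ℕ} (F : Instance n) : PMF ℝ≥0 :=
  F.law.map fun v => Finset.univ.sup v

/-- The product distribution of `k` independent copies of `F`. -/
def iid {α : Type} (F : PMF α) : (k : ℕ) → PMF (Fin k → α)
  | 0 => PMF.pure Fin.elim0
  | k + 1 => F.bind fun a => (iid F k).map fun v => (Fin.cons a v : Fin (k + 1) → α)

/-! ### Online algorithms in the block arrival model -/

/-- A randomized online algorithm for blocks of `n` rewards.  When reward `i` of round `t` arrives
(rounds and rewards are numbered from `0`), the algorithm sees its internal state, which may
remember anything about the past, and the prefix of the current block up to and including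
reward `i`.  It then randomly either accepts the reward (`none`) or rejects it and moves on to a
new state (`some s`). -/
structure OnlineAlgorithm (n : ℕ) where
  /-- internal states -/
  State : Type
  /-- initial state -/
  init : State
  /-- the randomized decision upon the arrival of a reward -/
  step : (t : ℕ) → (i : Fin n) → (Fin (i.val + 1) → ℝ≥0) → State → PMF (Option State)

namespace OnlineAlgorithm

variable {n : ℕ} (A : OnlineAlgorithm n)

/-- The situation after the first `m` rewards of block `v` in round `t`, when the round is entered
in state `s`: either the index of the accepted reward, or the current state. -/
def runPrefix (t : ℕ) (v : Fin n → ℝ≥0) (s : A.State) :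
    (m : ℕ) → m ≤ n → PMF (Fin n ⊕ A.State)
  | 0, _ => PMF.pure (Sum.inr s)
  | m + 1, h => (runPrefix t v s m (Nat.le_of_succ_le h)).bind fun o =>
      match o with
      | Sum.inl j => PMF.pure (Sum.inl j)
      | Sum.inr s' => (A.step t ⟨m, h⟩ (Fin.take (m + 1) h v) s').map fun d =>
          match d with
          | none => Sum.inl ⟨m, h⟩
          | some s'' => Sum.inr s''

/-- The outcome of the complete round `t` on block `v`, entered in state `s`. -/
def runBlock (t : ℕ) (v : Fin n → ℝ≥0) (s : A.State) : PMF (Fin n ⊕ A.State) :=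
  A.runPrefix t v s n le_rfl

/-- The value obtained from `k` further blocks, the first of which is round `t`, when that round is
entered in state `s`.  If nothing is accepted, the value is `0`. -/
def runFrom : (k : ℕ) → (t : ℕ) → A.State → (Fin k → Fin n → ℝ≥0) → PMF ℝ≥0
  | 0, _, _, _ => PMF.pure 0
  | k + 1, t, s, v => (A.runBlock t (v 0) s).bind fun o =>
      match o with
      | Sum.inl i => PMF.pure (v 0 i)
      | Sum.inr s' => runFrom k (t + 1) s' (Fin.tail v)

/-- The distribution of the value `ALG(v)` when `v` consists of `k` independent copies of `F`. -/
def value (F : Instance n) (k : ℕ) : PMF ℝ≥0 :=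
  (iid F.law k).bind (A.runFrom k 0 A.init)

end OnlineAlgorithm

/-! ### Competition complexity and stochastic domination -/

/-- The expectation of a discrete distribution over nonnegative numbers, possibly infinite. -/
def expect (D : PMF ℝ≥0) : ℝ≥0∞ := ∫⁻ x, (x : ℝ≥0∞) ∂D.toMeasure

/-- The `(1-ε)`-competition complexity of an algorithm (which knows the number of rounds `k` and the
distribution): the least positive integer `K` such that for every instance and every `k ≥ K`
the expected value of the algorithm on `k` independent copies is at least `1-ε` times the expected
maximum of one copy; it is `⊤` if there is no such `K`. -/
def competitionComplexity {n : ℕ} (ALG : ℕ → Instance n → OnlineAlgorithm n) (ε : ℝ) : ℕ∞ :=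
  sInf ((fun K : ℕ => (K : ℕ∞)) '' {K : ℕ | 0 < K ∧ ∀ F : Instance n, ∀ k : ℕ, K ≤ k →
    ENNReal.ofReal (1 - ε) * expect F.maxLaw ≤ expect ((ALG k F).value F k)})

/-- `Pr_{X ∼ D}[X < y]`. -/
def prLT (D : PMF ℝ≥0) (y : ℝ) : ℝ := D.toMeasure.real {x : ℝ≥0 | (x : ℝ) < y}

/-- `Pr_{X ∼ D}[X ≤ y]`. -/
def prLE (D : PMF ℝ≥0) (y : ℝ) : ℝ := D.toMeasure.real {x : ℝ≥0 | (x : ℝ) ≤ y}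

/-- `Pr_{X ∼ D}[X ≥ y]`. -/
def prGE (D : PMF ℝ≥0) (y : ℝ) : ℝ := D.toMeasure.real {x : ℝ≥0 | y ≤ (x : ℝ)}

/-- `T` is a `q`-quantile threshold of `D`. -/
def IsQuantile (D : PMF ℝ≥0) (q T : ℝ) : Prop := prLT D T ≤ q ∧ q ≤ prLE D T

/-- `D₁` stochastically dominates `D₂` up to the `ε`-quantile. -/
def DominatesUpTo (ε : ℝ) (D₁ D₂ : PMF ℝ≥0) : Prop :=
  ∀ y : ℝ, prGE D₂ y ≤ prGE D₁ y ∨ prLT D₂ y ≤ ε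

/-! ### The two-phase algorithm -/

/-- A Bernoulli variable with success probability `p`. -/
def coin (p : ℝ≥0) (h : p ≤ 1) : PMF Bool :=
  PMF.ofFintype (fun b => cond b (p : ℝ≥0∞) (1 - p)) (by
    have h' : (p : ℝ≥0∞) ≤ 1 := by exact_mod_cast h
    simpa using add_tsub_cancel_of_le h')

/-- The probability that, given the prefix `x` of the sequence, the last reward of `x` is the
maximum of the entire sequence. -/
def probMax {n : ℕ} (F : Instance n) {i : ℕ} (hi : i < n) (x : Fin (i + 1) → ℝ≥0) : ℝ≥0 :=
  ((ProbabilityTheory.cond F.law.toMeasure {v | Fin.take (i + 1) hi v = x})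
    {v | x (Fin.last i) = Finset.univ.sup v}).toNNReal

theorem probMax_le_one {n : ℕ} (F : Instance n) {i : ℕ} (hi : i < n) (x : Fin (i + 1) → ℝ≥0) :
    probMax F hi x ≤ 1 := by
  unfold probMax
  have h : (ProbabilityTheory.cond F.law.toMeasure {v | Fin.take (i + 1) hi v = x})
      {v | x (Fin.last i) = Finset.univ.sup v} ≤ 1 := by
    by_cases h0 : F.law.toMeasure {v | Fin.take (i + 1) hi v = x} = 0
    · rw [ProbabilityTheory.cond_eq_zero_of_meas_eq_zero h0]
      simp
    · have := ProbabilityTheory.cond_isProbabilityMeasure (μ := F.law.toMeasure) h0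
      exact MeasureTheory.prob_le_one
  simpa using ENNReal.toNNReal_mono ENNReal.one_ne_top h

/-- The total probability of the rewards strictly before the last one of the prefix `x`,
`∑_{j < i} probMax (x_{≤ j})`. -/
def probMaxBefore {n : ℕ} (F : Instance n) {i : ℕ} (hi : i < n) (x : Fin (i + 1) → ℝ≥0) : ℝ≥0 :=
  ∑ j : Fin i, probMax F (j.isLt.trans hi)
    (Fin.take (j.val + 1) (Nat.succ_le_succ j.isLt.le) x)

theorem probMaxBefore_le {n : ℕ} (F : Instance n) {i : ℕ} (hi : i < n) (x : Fin (i + 1) → ℝ≥0) :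
    probMaxBefore F hi x ≤ i := by
  unfold probMaxBefore
  refine (Finset.sum_le_card_nsmul _ _ 1 fun j _ => probMax_le_one F _ _).trans ?_
  simp

theorem priority_le_one {n : ℕ} (F : Instance n) {i : ℕ} (hi : i < n) (x : Fin (i + 1) → ℝ≥0) :
    1 / ((n : ℝ≥0) - probMaxBefore F hi x) ≤ 1 := by
  have h1 : (1 : ℝ≥0) ≤ (n : ℝ≥0) - probMaxBefore F hi x := by
    refine le_tsub_of_add_le_left ?_
    have h2 : (i : ℝ≥0) + 1 ≤ n := by exact_mod_cast hi
    exact (add_le_add_left (probMaxBefore_le F hi x) 1).trans h2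
  rw [one_div]
  exact inv_le_one_of_one_le₀ h1

/-- One step of the contention resolution scheme.  The state `a` says that no reward of the current
round has been selected yet, and it is reset to `true` at the first reward of the round.  Reward `i`
is active if `Y`, prioritized if `Z`, and it is selected (`none`) if it is active, prioritized, and
nothing was selected before it in this round. -/
def ocrsStep {n : ℕ} (F : Instance n) (i : Fin n) (x : Fin (i.val + 1) → ℝ≥0) (a : Bool) :
    PMF (Option Bool) :=
  let a' : Bool := if i.val = 0 then true else a
  (coin (probMax F i.isLt x) (probMax_le_one F i.isLt x)).bind fun Y =>
    (coin (1 / ((n : ℝ≥0) - probMaxBefore F i.isLt x)) (priority_le_one F i.isLt x)).bind fun Z =>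
      if Y = true ∧ Z = true ∧ a' = true then PMF.pure none else PMF.pure (some a')

/-- The contention resolution scheme alone, as an online selection rule. -/
def ocrs {n : ℕ} (F : Instance n) : OnlineAlgorithm n where
  State := Bool
  init := true
  step := fun _ i x a => ocrsStep F i x a

/-- One step of the first phase: a reward selected by the contention resolution scheme is accepted
if it exceeds the threshold `T₀`; otherwise the rest of the round is skipped. -/
def phaseOneStep {n : ℕ} (F : Instance n) (T₀ : ℝ) (i : Fin n) (x : Fin (i.val + 1) → ℝ≥0)
    (a : Bool) : PMF (Option Bool) :=
  (ocrsStep F i x a).map fun d =>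
    match d with
    | none => if T₀ < (x (Fin.last i.val) : ℝ) then none else some false
    | some a' => some a'

/-- One step of a plain threshold rule. -/
def thresholdStep {i : ℕ} (T : ℝ) (x : Fin (i + 1) → ℝ≥0) (a : Bool) : PMF (Option Bool) :=
  if T ≤ (x (Fin.last i) : ℝ) then PMF.pure none else PMF.pure (some a)

/-- `r = ⌈log log (1/ε) + log n⌉`, with logarithms to base `2`. -/
def rExp (n : ℕ) (ε : ℝ) : ℤ :=
  ⌈Real.logb 2 (Real.logb 2 (1 / ε)) + Real.logb 2 n⌉

/-- The number of rounds of the first phase. -/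
def phaseOneRounds (n : ℕ) : ℕ := n + 1

/-- The number of rounds of the second phase. -/
def phaseTwoRounds (n : ℕ) (ε : ℝ) : ℕ := (rExp n ε + 2).toNat

/-- Admissible thresholds: `T 0` is a `(1-1/n)`-quantile threshold of the distribution of the
maximum and, with `p = Pr[max_j v_j < T 0]`, `T i` is a `p^(2^i)`-quantile threshold of it. -/
structure IsThresholdSeq {n : ℕ} (F : Instance n) (T : ℕ → ℝ) : Prop where
  zero : IsQuantile F.maxLaw (1 - 1 / (n : ℝ)) (T 0)
  pos : ∀ i : ℕ, 1 ≤ i → IsQuantile F.maxLaw (prLT F.maxLaw (T 0) ^ (2 ^ i)) (T i)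

/-- The two-phase algorithm with thresholds `T`.  The first `n + 1` rounds run the contention
resolution scheme with threshold `T 0`; the next `r + 2` rounds use the thresholds
`T 0, T 0, T 1, T 2, …, T r` (subtraction of natural numbers truncates at `0`); afterwards nothing
is accepted. -/
def twoPhase {n : ℕ} (F : Instance n) (T : ℕ → ℝ) (ε : ℝ) : OnlineAlgorithm n where
  State := Bool
  init := true
  step := fun t i x a =>
    if t < phaseOneRounds n then phaseOneStep F (T 0) i x a
    else if t < phaseOneRounds n + phaseTwoRounds n ε then
      thresholdStep (T (t - phaseOneRounds n - 1)) x a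
    else PMF.pure (some a)

end CorrProphet

end

/-!
The coins `Z_i` are calibrated so that, by induction on `i`, no reward before `i` is selected with
probability `1 - (1/n) ∑_{j<i} PM(v_{≤j})`; hence `i` is selected with probability `PM(v_{≤i})/n`.
Averaging over the block, a round of the first phase accepts a value in `S` with probability
`Pr[max ∈ S, max > T₀] / n`.

For `y > T₀`, each of the `n + 1` rounds of the first phase accepts a value `≥ y` with probability
`Pr[max ≥ y] / n` and stops with probability at most `1/n²`, because `Pr[max > T₀] ≤ 1/n`. So the
accepted value is at least `y` with probability at least
`(Pr[max ≥ y] / n) ∑_{i≤n} (1 - 1/n²)^i ≥ Pr[max ≥ y]`, by Bernoulli's inequality.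

For `T_r ≤ y ≤ T₀`, let `T_{j+1}` be the first threshold below `y` (if there is none, `y = T_r` and
the last round alone suffices). To end up below `y`, the algorithm must see only rewards below the
threshold in the rounds of the second phase that use `T₀, T₀, T₁, …, T_j`. Their factors
`p, p, p², …, p^{2^j}` telescope to `p^{2^{j+1}} ≤ Pr[max ≤ T_{j+1}] ≤ Pr[max < y]`.

Finally `p ≤ 1 - 1/n` gives `Pr[max < T_r] ≤ p^{2^r} ≤ exp(-2^r/n) ≤ ε`.
-/

noncomputable section

namespace CorrProphet

section Discrete

variable {α σ : Type*}

theorem ennreal_tsum_option (f : Option α → ℝ≥0∞) : ∑' o, f o = f none + ∑' a, f (some a) := by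
  rw [← (Equiv.optionEquivSumPUnit.{0} α).symm.tsum_eq,
    Summable.tsum_sum ENNReal.summable ENNReal.summable, add_comm]
  simp

theorem toOuterMeasure_le_one (p : PMF α) (S : Set α) : p.toOuterMeasure S ≤ 1 :=
  (p.toOuterMeasure.mono S.subset_univ).trans_eq
    ((p.toOuterMeasure_apply_eq_one_iff _).2 (Set.subset_univ _))

theorem toOuterMeasure_ne_top (p : PMF α) (S : Set α) : p.toOuterMeasure S ≠ ∞ :=
  ne_top_of_le_ne_top ENNReal.one_ne_top (toOuterMeasure_le_one p S)

theorem toOuterMeasure_range_inr (p : PMF (α ⊕ σ)) :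
    p.toOuterMeasure (Set.range Sum.inr) = ∑' s, p (Sum.inr s) := by
  rw [PMF.toOuterMeasure_apply, Summable.tsum_sum ENNReal.summable ENNReal.summable]
  simp

theorem toOuterMeasure_range_inr_eq_one_sub (p : PMF (α ⊕ σ)) :
    p.toOuterMeasure (Set.range Sum.inr) = 1 - p.toOuterMeasure (Set.range Sum.inl) := by
  refine ENNReal.eq_sub_of_add_eq (toOuterMeasure_ne_top _ _) ?_
  rw [← p.tsum_coe, Summable.tsum_sum ENNReal.summable ENNReal.summable,
    toOuterMeasure_range_inr, PMF.toOuterMeasure_apply,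
    Summable.tsum_sum ENNReal.summable ENNReal.summable, add_comm]
  simp

theorem toOuterMeasure_bind_sumElim_pure (p : PMF (α ⊕ σ)) (f : σ → PMF α) (S : Set α) :
    (p.bind (Sum.elim PMF.pure f)).toOuterMeasure S =
      p.toOuterMeasure (Sum.inl '' S) + ∑' s, p (Sum.inr s) * (f s).toOuterMeasure S := by
  classical
  rw [PMF.toOuterMeasure_bind_apply, PMF.toOuterMeasure_apply,
    Summable.tsum_sum ENNReal.summable ENNReal.summable,
    Summable.tsum_sum ENNReal.summable ENNReal.summable]
  simp [Set.indicator_apply]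

theorem toOuterMeasure_bind_sumElim_pure_le (p : PMF (α ⊕ σ)) {f : σ → PMF α} {S : Set α}
    {c : ℝ≥0∞} (hc : ∀ s, (f s).toOuterMeasure S ≤ c) :
    (p.bind (Sum.elim PMF.pure f)).toOuterMeasure S ≤
      p.toOuterMeasure (Sum.inl '' S) + p.toOuterMeasure (Set.range Sum.inr) * c := by
  rw [toOuterMeasure_bind_sumElim_pure, toOuterMeasure_range_inr, ← ENNReal.tsum_mul_right]
  gcongr
  exact hc _

theorem le_toOuterMeasure_bind_sumElim_pure (p : PMF (α ⊕ σ)) {f : σ → PMF α} {S : Set α}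
    {c : ℝ≥0∞} (hc : ∀ s, c ≤ (f s).toOuterMeasure S) :
    p.toOuterMeasure (Sum.inl '' S) + (1 - p.toOuterMeasure (Set.range Sum.inl)) * c ≤
      (p.bind (Sum.elim PMF.pure f)).toOuterMeasure S := by
  rw [toOuterMeasure_bind_sumElim_pure, ← toOuterMeasure_range_inr_eq_one_sub,
    toOuterMeasure_range_inr, ← ENNReal.tsum_mul_right]
  gcongr
  exact hc _

theorem tsum_mul_cond_fiber {β : Type*} [MeasurableSpace α] [MeasurableSingletonClass α]
    [MeasurableSpace β] [MeasurableSingletonClass β] (p : PMF α) {f : α → β} (hf : Measurable f)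
    (A : Set α) (g : β → ℝ≥0∞) :
    ∑' a, p a * (g (f a) * ProbabilityTheory.cond p.toMeasure (f ⁻¹' {f a}) A) =
      ∑' a, A.indicator p a * g (f a) := by
  rw [← ENNReal.tsum_fiberwise _ f, ← ENNReal.tsum_fiberwise (fun a => A.indicator p a * g (f a)) f]
  refine tsum_congr fun b => ?_
  calc ∑' a : f ⁻¹' {b}, p a * (g (f a) * ProbabilityTheory.cond p.toMeasure (f ⁻¹' {f a}) A)
      = (∑' a : f ⁻¹' {b}, p a) * (g b * ProbabilityTheory.cond p.toMeasure (f ⁻¹' {b}) A) := by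
        rw [← ENNReal.tsum_mul_right]
        refine tsum_congr fun a => ?_
        rw [show f a = b from a.2]
    _ = p.toMeasure (f ⁻¹' {b} ∩ A) * g b := by
        rw [← ProbabilityTheory.cond_mul_eq_inter (hf (measurableSet_singleton b)),
          PMF.toMeasure_apply_eq_toOuterMeasure p (f ⁻¹' {b}), PMF.toOuterMeasure_apply,
          ← tsum_subtype]
        ring
    _ = ∑' a : f ⁻¹' {b}, A.indicator p a * g (f a) := by
        rw [PMF.toMeasure_apply_eq_toOuterMeasure, PMF.toOuterMeasure_apply,
          ← Set.indicator_indicator, ← tsum_subtype, ← ENNReal.tsum_mul_right]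
        refine tsum_congr fun a => ?_
        rw [show f a = b from a.2]

end Discrete

namespace OnlineAlgorithm

variable {n : ℕ} (A : OnlineAlgorithm n) (F : Instance n)

/-- The distribution of the value obtained from `k` further independent blocks, the first of which
is round `t`, when that round is entered in state `s`. -/
def valueFrom (k t : ℕ) (s : A.State) : PMF ℝ≥0 :=
  (iid F.law k).bind (A.runFrom k t s)

/-- The outcome of round `t`, entered in state `s`, on a random block: the value of the accepted
reward, or the state in which the next round is entered. -/
def roundLaw (t : ℕ) (s : A.State) : PMF (ℝ≥0 ⊕ A.State) :=
  F.law.bind fun v => (A.runBlock t v s).map (Sum.map v id)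

theorem valueFrom_succ (k t : ℕ) (s : A.State) :
    A.valueFrom F (k + 1) t s =
      (A.roundLaw F t s).bind (Sum.elim PMF.pure (A.valueFrom F k (t + 1))) := by
  rw [valueFrom, iid, roundLaw, PMF.bind_bind, PMF.bind_bind]
  congr! 2 with v
  calc ((iid F.law k).map fun w => Fin.cons v w).bind (A.runFrom (k + 1) t s)
      = (iid F.law k).bind fun w => (A.runBlock t v s).bind
          (Sum.elim (fun i => PMF.pure (v i)) fun s' => A.runFrom k (t + 1) s' w) := by
        rw [PMF.bind_map]
        congr! 2 with w
        rw [Function.comp_apply, runFrom]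
        congr! 2 with o
        cases o <;> rfl
    _ = ((A.runBlock t v s).map (Sum.map v id)).bind
          (Sum.elim PMF.pure (A.valueFrom F k (t + 1))) := by
        rw [PMF.bind_comm, PMF.bind_map]
        congr! 2 with o
        cases o
        · exact PMF.bind_const _ _
        · rfl

variable {A F}

theorem valueFrom_le_prod {S : Set ℝ≥0} {c : ℕ → ℝ≥0∞} {m k t : ℕ} (hmk : m ≤ k)
    (hacc : ∀ u < m, ∀ s, (A.roundLaw F (t + u) s).toOuterMeasure (Sum.inl '' S) = 0)
    (hcont : ∀ u < m, ∀ s, (A.roundLaw F (t + u) s).toOuterMeasure (Set.range Sum.inr) ≤ c u)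
    (s : A.State) :
    (A.valueFrom F k t s).toOuterMeasure S ≤ ∏ u ∈ Finset.range m, c u := by
  induction m generalizing k t c s with
  | zero => simpa using toOuterMeasure_le_one _ _
  | succ m ih =>
    obtain ⟨k, rfl⟩ := Nat.exists_eq_add_of_le' (Nat.one_le_of_lt hmk)
    have hrest (s' : A.State) : (A.valueFrom F k (t + 1) s').toOuterMeasure S ≤
        ∏ u ∈ Finset.range m, c (u + 1) :=
      ih (by omega)
        (fun u hu => by simpa only [add_assoc, add_comm 1] using hacc (u + 1) (by omega))
        (fun u hu => by simpa only [add_assoc, add_comm 1] using hcont (u + 1) (by omega)) s'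
    rw [valueFrom_succ, Finset.prod_range_succ', mul_comm]
    refine (toOuterMeasure_bind_sumElim_pure_le _ hrest).trans ?_
    rw [show A.roundLaw F t s = A.roundLaw F (t + 0) s from rfl, hacc 0 m.succ_pos s, zero_add]
    gcongr
    exact hcont 0 m.succ_pos s

theorem mul_geom_sum_le_valueFrom {S : Set ℝ≥0} {a b : ℝ≥0∞} {m k t : ℕ} (hmk : m ≤ k)
    (ha : ∀ u < m, ∀ s, a ≤ (A.roundLaw F (t + u) s).toOuterMeasure (Sum.inl '' S))
    (hb : ∀ u < m, ∀ s, (A.roundLaw F (t + u) s).toOuterMeasure (Set.range Sum.inl) ≤ b)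
    (s : A.State) :
    a * ∑ i ∈ Finset.range m, (1 - b) ^ i ≤ (A.valueFrom F k t s).toOuterMeasure S := by
  induction m generalizing k t s with
  | zero => simp
  | succ m ih =>
    obtain ⟨k, rfl⟩ := Nat.exists_eq_add_of_le' (Nat.one_le_of_lt hmk)
    have hrest (s' : A.State) : a * ∑ i ∈ Finset.range m, (1 - b) ^ i ≤
        (A.valueFrom F k (t + 1) s').toOuterMeasure S :=
      ih (by omega) (fun u hu => by simpa only [add_assoc, add_comm 1] using ha (u + 1) (by omega))
        (fun u hu => by simpa only [add_assoc, add_comm 1] using hb (u + 1) (by omega)) s'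
    rw [valueFrom_succ]
    refine le_trans ?_ (le_toOuterMeasure_bind_sumElim_pure _ hrest)
    rw [geom_sum_succ, mul_add, mul_one, add_comm, mul_left_comm]
    gcongr
    · exact ha 0 m.succ_pos s
    · exact hb 0 m.succ_pos s

theorem toOuterMeasure_roundLaw (t : ℕ) (s : A.State) (R : Set (ℝ≥0 ⊕ A.State)) :
    (A.roundLaw F t s).toOuterMeasure R =
      ∑' v, F.law v * (A.runBlock t v s).toOuterMeasure (Sum.map v id ⁻¹' R) := by
  simp only [roundLaw, PMF.toOuterMeasure_bind_apply, PMF.toOuterMeasure_map_apply]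

theorem toOuterMeasure_roundLaw_inl (t : ℕ) (s : A.State) (S : Set ℝ≥0) :
    (A.roundLaw F t s).toOuterMeasure (Sum.inl '' S) =
      ∑' v, F.law v * ∑ i, S.indicator 1 (v i) * A.runBlock t v s (Sum.inl i) := by
  classical
  rw [toOuterMeasure_roundLaw]
  congr! 3 with v
  rw [PMF.toOuterMeasure_apply, Summable.tsum_sum ENNReal.summable ENNReal.summable, tsum_fintype]
  simp [Set.indicator_apply]

theorem toOuterMeasure_roundLaw_range_inr (t : ℕ) (s : A.State) :
    (A.roundLaw F t s).toOuterMeasure (Set.range Sum.inr) =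
      ∑' v, F.law v * (A.runBlock t v s).toOuterMeasure (Set.range Sum.inr) := by
  rw [toOuterMeasure_roundLaw]
  congr! 4 with v
  ext (_ | _) <;> simp

variable {t m : ℕ} {v : Fin n → ℝ≥0} {s s' : A.State}

theorem runPrefix_succ {h : m + 1 ≤ n} :
    A.runPrefix t v s (m + 1) h = (A.runPrefix t v s m (Nat.le_of_succ_le h)).bind
      (Sum.elim (PMF.pure ∘ Sum.inl) fun a =>
        (A.step t ⟨m, h⟩ (Fin.take (m + 1) h v) a).map
          fun d => d.elim (Sum.inl ⟨m, h⟩) Sum.inr) := by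
  refine congrArg (PMF.bind _) (funext fun o => ?_)
  rcases o with j | a
  · rfl
  · exact congrArg (PMF.map · _) (funext fun d => by cases d <;> rfl)

theorem runPrefix_succ_inl {h : m + 1 ≤ n} (i : Fin n) :
    A.runPrefix t v s (m + 1) h (Sum.inl i) =
      A.runPrefix t v s m (Nat.le_of_succ_le h) (Sum.inl i) +
        if i = ⟨m, h⟩ then ∑' a, A.runPrefix t v s m (Nat.le_of_succ_le h) (Sum.inr a) *
          A.step t ⟨m, h⟩ (Fin.take (m + 1) h v) a none else 0 := by
  classical
  rw [runPrefix, PMF.bind_apply, Summable.tsum_sum ENNReal.summable ENNReal.summable]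
  congr 1
  · simp [PMF.pure_apply]
  · simp only [PMF.map_apply, ennreal_tsum_option]
    by_cases hi : i = ⟨m, h⟩ <;> simp [hi]

theorem runPrefix_succ_inr {h : m + 1 ≤ n} :
    A.runPrefix t v s (m + 1) h (Sum.inr s') =
      ∑' a, A.runPrefix t v s m (Nat.le_of_succ_le h) (Sum.inr a) *
        A.step t ⟨m, h⟩ (Fin.take (m + 1) h v) a (some s') := by
  classical
  rw [runPrefix, PMF.bind_apply, Summable.tsum_sum ENNReal.summable ENNReal.summable]
  simp [PMF.pure_apply, PMF.map_apply, ennreal_tsum_option]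

theorem runPrefix_inl_of_le {i : Fin n} {h : m ≤ n} (hm : m ≤ i) :
    A.runPrefix t v s m h (Sum.inl i) = 0 := by
  induction m with
  | zero => simp [runPrefix, PMF.pure_apply]
  | succ m ih => rw [runPrefix_succ_inl, ih (by omega), if_neg (by grind), zero_add]

theorem runPrefix_inl_of_lt {i : Fin n} {h : m ≤ n} (hm : i < m) :
    A.runPrefix t v s m h (Sum.inl i) =
      ∑' a, A.runPrefix t v s i i.isLt.le (Sum.inr a) *
        A.step t i (Fin.take (i + 1) i.isLt v) a none := by
  induction m with
  | zero => simp at hm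
  | succ m ih =>
    rw [runPrefix_succ_inl]
    rcases Nat.lt_succ_iff_lt_or_eq.1 hm with hlt | rfl
    · rw [ih hlt, if_neg (by grind), add_zero]
    · rw [runPrefix_inl_of_le le_rfl, zero_add, if_pos rfl]

theorem runBlock_inl (i : Fin n) :
    A.runBlock t v s (Sum.inl i) =
      ∑' a, A.runPrefix t v s i i.isLt.le (Sum.inr a) *
        A.step t i (Fin.take (i + 1) i.isLt v) a none :=
  runPrefix_inl_of_lt i.isLt

theorem toOuterMeasure_roundLaw_inl_eq_zero {S : Set ℝ≥0}
    (hS : ∀ i x a, none ∈ (A.step t i x a).support → x (Fin.last i) ∉ S) (s : A.State) :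
    (A.roundLaw F t s).toOuterMeasure (Sum.inl '' S) = 0 := by
  classical
  rw [toOuterMeasure_roundLaw_inl]
  refine ENNReal.tsum_eq_zero.2 fun v => mul_eq_zero_of_right _ (Finset.sum_eq_zero fun i _ => ?_)
  by_cases hi : v i ∈ S
  · rw [runBlock_inl]
    refine mul_eq_zero_of_right _ (ENNReal.tsum_eq_zero.2 fun a => mul_eq_zero_of_right _ ?_)
    by_contra hne
    exact hS i _ a hne hi
  · rw [Set.indicator_of_notMem hi, zero_mul]

theorem runPrefix_inr_eq_zero {S : Set ℝ≥0}
    (hS : ∀ i x a b, some b ∈ (A.step t i x a).support → x (Fin.last i) ∈ S) {h : m ≤ n}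
    {j : Fin n} (hjm : j < m) (hj : v j ∉ S) :
    A.runPrefix t v s m h (Sum.inr s') = 0 := by
  induction m generalizing s' with
  | zero => simp at hjm
  | succ m ih =>
    rw [runPrefix_succ_inr]
    refine ENNReal.tsum_eq_zero.2 fun a => ?_
    rcases Nat.lt_succ_iff_lt_or_eq.1 hjm with hlt | rfl
    · rw [ih hlt, zero_mul]
    · refine mul_eq_zero_of_right _ ?_
      by_contra hne
      exact hj (hS j _ a s' hne)

theorem toOuterMeasure_roundLaw_range_inr_le {S : Set ℝ≥0}
    (hS : ∀ i x a b, some b ∈ (A.step t i x a).support → x (Fin.last i) ∈ S) (s : A.State) :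
    (A.roundLaw F t s).toOuterMeasure (Set.range Sum.inr) ≤
      F.law.toOuterMeasure {v | ∀ i, v i ∈ S} := by
  classical
  rw [toOuterMeasure_roundLaw_range_inr, PMF.toOuterMeasure_apply]
  refine ENNReal.tsum_le_tsum fun v => ?_
  by_cases hv : ∀ i, v i ∈ S
  · rw [Set.indicator_of_mem (show v ∈ {v | ∀ i, v i ∈ S} from hv)]
    exact mul_le_of_le_one_right' (toOuterMeasure_le_one _ _)
  · push Not at hv
    obtain ⟨j, hj⟩ := hv
    have hzero (s' : A.State) : A.runBlock t v s (Sum.inr s') = 0 :=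
      runPrefix_inr_eq_zero hS j.isLt hj
    simp [toOuterMeasure_range_inr, hzero]

end OnlineAlgorithm

theorem Instance.pos {n : ℕ} (F : Instance n) : 0 < n := by
  obtain ⟨v, hv⟩ := F.law.support_nonempty
  obtain ⟨j, -⟩ := F.unique_max v hv
  exact j.pos

section ContentionResolution

variable {n : ℕ} (F : Instance n)

/-- The probability that reward `i` of the block `v` is active: `PM(v_{≤ i})`. -/
def activeProb (v : Fin n → ℝ≥0) (i : Fin n) : ℝ≥0 :=
  probMax F i.isLt (Fin.take (i + 1) i.isLt v)

/-- The probability that reward `i` is selected upon its arrival when no reward of the block was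
selected before it; `x` is the prefix of the block up to reward `i`. -/
def selectProb (i : Fin n) (x : Fin (i.val + 1) → ℝ≥0) : ℝ≥0 :=
  probMax F i.isLt x * (1 / ((n : ℝ≥0) - probMaxBefore F i.isLt x))

theorem ocrsStep_none (i : Fin n) (x : Fin (i.val + 1) → ℝ≥0) :
    ocrsStep F i x true none = selectProb F i x := by
  simp [ocrsStep, selectProb, coin, PMF.bind_apply, PMF.pure_apply]

theorem ocrsStep_some_false (i : Fin n) (x : Fin (i.val + 1) → ℝ≥0) :
    ocrsStep F i x true (some false) = 0 := by
  simp [ocrsStep, PMF.bind_apply, PMF.pure_apply]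

theorem ocrsStep_some_true (i : Fin n) (x : Fin (i.val + 1) → ℝ≥0) :
    ocrsStep F i x true (some true) = 1 - selectProb F i x := by
  have htotal := (ocrsStep F i x true).tsum_coe
  rw [ennreal_tsum_option, tsum_bool, ocrsStep_none, ocrsStep_some_false, zero_add,
    add_comm] at htotal
  exact ENNReal.eq_sub_of_add_eq ENNReal.coe_ne_top htotal

theorem ocrsStep_reset {i : Fin n} (hi : i.val = 0) (x : Fin (i.val + 1) → ℝ≥0) (a : Bool) :
    ocrsStep F i x a = ocrsStep F i x true := by
  simp [ocrsStep, hi]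

theorem ocrs_runPrefix_reset (t : ℕ) (v : Fin n → ℝ≥0) (s : Bool) {m : ℕ} (h : m + 1 ≤ n) :
    (ocrs F).runPrefix t v s (m + 1) h = (ocrs F).runPrefix t v true (m + 1) h := by
  induction m with
  | zero =>
    simp only [OnlineAlgorithm.runPrefix, PMF.pure_bind]
    rw [show (ocrs F).step t ⟨0, h⟩ _ s = _ from ocrsStep_reset F rfl _ s]
    rfl
  | succ m ih => exact congrArg (PMF.bind · _) (ih _)

theorem ocrs_runBlock_reset (t : ℕ) (v : Fin n → ℝ≥0) (s : Bool) :
    (ocrs F).runBlock t v s = (ocrs F).runBlock t v true := by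
  obtain ⟨m, rfl⟩ := Nat.exists_eq_add_of_le' F.pos
  exact ocrs_runPrefix_reset F t v s le_rfl

theorem one_sub_mul_selectProb (v : Fin n → ℝ≥0) (i : Fin n) :
    (1 - (∑ j : Fin i, activeProb F v (j.castLE i.isLt.le)) / n) *
      selectProb F i (Fin.take (i + 1) i.isLt v) = activeProb F v i / n := by
  have hn : (n : ℝ≥0) ≠ 0 := by exact_mod_cast i.pos.ne'
  set σ := probMaxBefore F i.isLt (Fin.take (i + 1) i.isLt v)
  have hσ : σ < n := (probMaxBefore_le F i.isLt _).trans_lt (by exact_mod_cast i.isLt)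
  have hd : (n : ℝ≥0) - σ ≠ 0 := (tsub_pos_of_lt hσ).ne'
  calc (1 - σ / n) * (activeProb F v i * (1 / (n - σ)))
      = (n - σ) / n * (activeProb F v i * (1 / (n - σ))) := by rw [NNReal.sub_div, div_self hn]
    _ = activeProb F v i / n := by field_simp

theorem ocrs_runPrefix_inr (t : ℕ) (v : Fin n → ℝ≥0) {m : ℕ} (h : m ≤ n) :
    (ocrs F).runPrefix t v true m h (Sum.inr false) = 0 ∧
      (ocrs F).runPrefix t v true m h (Sum.inr true) =
        ((1 - (∑ j : Fin m, activeProb F v (j.castLE h)) / n : ℝ≥0) : ℝ≥0∞) := by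
  induction m with
  | zero =>
    refine ⟨PMF.pure_apply_of_ne _ _ (Sum.inr_injective.ne Bool.false_ne_true), ?_⟩
    simp [OnlineAlgorithm.runPrefix]
  | succ m ih =>
    obtain ⟨ihfalse, ihtrue⟩ := ih (Nat.le_of_succ_le h)
    have hstep (b : Bool) : (ocrs F).runPrefix t v true (m + 1) h (Sum.inr b) =
        ((1 - (∑ j : Fin m, activeProb F v (j.castLE (Nat.le_of_succ_le h))) / n : ℝ≥0) : ℝ≥0∞) *
          ocrsStep F ⟨m, h⟩ (Fin.take (m + 1) h v) true (some b) := by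
      refine OnlineAlgorithm.runPrefix_succ_inr.trans ((tsum_bool _).trans ?_)
      rw [ihfalse, zero_mul, zero_add, ihtrue]
      rfl
    rw [hstep, hstep, ocrsStep_some_false, ocrsStep_some_true]
    refine ⟨mul_zero _, ?_⟩
    rw [← ENNReal.coe_one, ← ENNReal.coe_sub, ← ENNReal.coe_mul, ENNReal.coe_inj, mul_tsub,
      one_sub_mul_selectProb F v ⟨m, h⟩, mul_one, tsub_tsub, Fin.sum_univ_castSucc, add_div]
    rfl

theorem ocrs_runBlock_inl (t : ℕ) (s : Bool) (v : Fin n → ℝ≥0) (i : Fin n) :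
    (ocrs F).runBlock t v s (Sum.inl i) = 1 / n * (activeProb F v i : ℝ≥0∞) := by
  have hn : (n : ℝ≥0) ≠ 0 := by exact_mod_cast i.pos.ne'
  obtain ⟨hfalse, htrue⟩ := ocrs_runPrefix_inr F t v i.isLt.le
  rw [ocrs_runBlock_reset]
  refine (OnlineAlgorithm.runBlock_inl i).trans ((tsum_bool _).trans ?_)
  rw [hfalse, zero_mul, zero_add, htrue,
    show (ocrs F).step t i _ true none = _ from ocrsStep_none F i _, ← ENNReal.coe_mul,
    one_sub_mul_selectProb, ENNReal.coe_div hn, ENNReal.coe_natCast, div_eq_mul_inv, mul_comm,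
    one_div]

theorem measurable_take {i : ℕ} (hi : i < n) :
    Measurable (Fin.take (i + 1) hi : (Fin n → ℝ≥0) → Fin (i + 1) → ℝ≥0) :=
  measurable_pi_lambda _ fun _ => measurable_pi_apply _

theorem coe_activeProb (v : Fin n → ℝ≥0) (i : Fin n) :
    (activeProb F v i : ℝ≥0∞) = ProbabilityTheory.cond F.law.toMeasure
      (Fin.take (i + 1) i.isLt ⁻¹' {Fin.take (i + 1) i.isLt v}) {w | w i = Finset.univ.sup w} := by
  have hfiber := measurable_take i.isLt (measurableSet_singleton (Fin.take (i + 1) i.isLt v))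
  rw [activeProb, probMax, ENNReal.coe_toNNReal (MeasureTheory.measure_ne_top _ _),
    ← ProbabilityTheory.cond_inter_self hfiber {w | w i = Finset.univ.sup w}]
  refine (ProbabilityTheory.cond_inter_self hfiber _ _).symm.trans ?_
  congr 1
  ext w
  refine and_congr_right fun hw => ?_
  rw [Set.mem_ofPred_eq, ← hw]
  rfl

theorem tsum_law_mul_activeProb (S : Set ℝ≥0) :
    ∑' v, F.law v * ∑ i, S.indicator 1 (v i) * (activeProb F v i : ℝ≥0∞) =
      F.maxLaw.toOuterMeasure S := by
  classical
  have hprefix (i : Fin n) :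
      ∑' v, F.law v * (S.indicator 1 (v i) * (activeProb F v i : ℝ≥0∞)) =
        ∑' v, {w | w i = Finset.univ.sup w}.indicator F.law v * S.indicator 1 (v i) := by
    simp only [coe_activeProb]
    exact tsum_mul_cond_fiber F.law (measurable_take i.isLt) _
      fun x => S.indicator 1 (x (Fin.last i))
  simp only [Finset.mul_sum]
  rw [Summable.tsum_finsetSum fun _ _ => ENNReal.summable]
  simp only [hprefix]
  rw [← Summable.tsum_finsetSum fun _ _ => ENNReal.summable, Instance.maxLaw,
    PMF.toOuterMeasure_map_apply, PMF.toOuterMeasure_apply]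
  refine tsum_congr fun v => ?_
  by_cases hv : v ∈ F.law.support
  · obtain ⟨j, hj, huniq⟩ := F.unique_max v hv
    rw [Finset.sum_eq_single_of_mem j (Finset.mem_univ j)]
    · simp [Set.indicator_apply, hj]
    · intro i _ hij
      rw [Set.indicator_of_notMem (show v ∉ {w | w i = Finset.univ.sup w} from
        fun h => hij (huniq i h)), zero_mul]
  · simp [Set.indicator_apply, (F.law.apply_eq_zero_iff v).2 hv]

end ContentionResolution

section Rounds

variable {n : ℕ} (F : Instance n) (T : ℕ → ℝ) {ε : ℝ}

/-- The effect of a threshold on the outcome of a round of the contention resolution scheme: a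
selected reward that does not exceed `T₀` is dropped, which leaves state `false`. -/
def screen (T₀ : ℝ) (v : Fin n → ℝ≥0) : Fin n ⊕ Bool → Fin n ⊕ Bool
  | Sum.inl i => if T₀ < v i then Sum.inl i else Sum.inr false
  | Sum.inr a => Sum.inr a

theorem screen_eq_inl {T₀ : ℝ} {v : Fin n → ℝ≥0} {o : Fin n ⊕ Bool} {i : Fin n} :
    screen T₀ v o = Sum.inl i ↔ T₀ < v i ∧ o = Sum.inl i := by
  rcases o with j | a
  · rw [screen]
    split_ifs with hj <;> grind
  · simp [screen]

theorem map_screen_inl (T₀ : ℝ) (v : Fin n → ℝ≥0) (p : PMF (Fin n ⊕ Bool)) (i : Fin n) :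
    p.map (screen T₀ v) (Sum.inl i) = if T₀ < v i then p (Sum.inl i) else 0 := by
  classical
  simp only [PMF.map_apply, eq_comm (a := Sum.inl i), screen_eq_inl, ite_and]
  split_ifs
  · rw [tsum_ite_eq]
  · exact tsum_zero

theorem phaseOneStep_false {i : Fin n} (hi : i.val ≠ 0) (T₀ : ℝ) (x : Fin (i.val + 1) → ℝ≥0) :
    phaseOneStep F T₀ i x false = PMF.pure (some false) := by
  simp [phaseOneStep, ocrsStep, hi, PMF.pure_map]

theorem map_elim_phaseOneStep (T₀ : ℝ) (v : Fin n → ℝ≥0) (i : Fin n) (a : Bool) :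
    (phaseOneStep F T₀ i (Fin.take (i + 1) i.isLt v) a).map (fun d => d.elim (Sum.inl i) Sum.inr) =
      ((ocrsStep F i (Fin.take (i + 1) i.isLt v) a).map
        (fun d => d.elim (Sum.inl i) Sum.inr)).map (screen T₀ v) := by
  rw [phaseOneStep, PMF.map_comp, PMF.map_comp]
  congr 1
  funext d
  rcases d with _ | a
  · change (if T₀ < v i then none else some false : Option Bool).elim _ _ =
      if T₀ < v i then Sum.inl i else Sum.inr false
    split_ifs <;> rfl
  · rfl

theorem twoPhase_step_of_lt {t : ℕ} (ht : t < phaseOneRounds n) (i : Fin n)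
    (x : Fin (i.val + 1) → ℝ≥0) (a : Bool) :
    (twoPhase F T ε).step t i x a = phaseOneStep F (T 0) i x a :=
  if_pos ht

theorem twoPhase_runPrefix_of_lt {t : ℕ} (ht : t < phaseOneRounds n) (v : Fin n → ℝ≥0) (s : Bool)
    {m : ℕ} (h : m ≤ n) :
    (twoPhase F T ε).runPrefix t v s m h = ((ocrs F).runPrefix t v s m h).map (screen (T 0) v) := by
  let p (m : ℕ) (h : m ≤ n) : PMF (Fin n ⊕ Bool) := (ocrs F).runPrefix t v s m h
  let q (m : ℕ) (h : m ≤ n) : PMF (Fin n ⊕ Bool) := (twoPhase F T ε).runPrefix t v s m h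
  let next (i : Fin n) (step : Bool → PMF (Option Bool)) : Fin n ⊕ Bool → PMF (Fin n ⊕ Bool) :=
    Sum.elim (PMF.pure ∘ Sum.inl) fun a => (step a).map fun d => d.elim (Sum.inl i) Sum.inr
  have hp (m : ℕ) (h : m + 1 ≤ n) : p (m + 1) h =
      (p m (Nat.le_of_succ_le h)).bind (next ⟨m, h⟩ (ocrsStep F ⟨m, h⟩ (Fin.take (m + 1) h v))) :=
    OnlineAlgorithm.runPrefix_succ
  have hq (m : ℕ) (h : m + 1 ≤ n) : q (m + 1) h =
      (q m (Nat.le_of_succ_le h)).bind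
        (next ⟨m, h⟩ (phaseOneStep F (T 0) ⟨m, h⟩ (Fin.take (m + 1) h v))) :=
    OnlineAlgorithm.runPrefix_succ.trans <|
      congrArg (fun step => (q m _).bind (next ⟨m, h⟩ step))
        (funext fun a => twoPhase_step_of_lt F T ht ⟨m, h⟩ (Fin.take (m + 1) h v) a)
  change q m h = (p m h).map (screen (T 0) v)
  induction m with
  | zero => exact (PMF.pure_map (screen (T 0) v) (Sum.inr s)).symm
  | succ m ih =>
    rw [hp, hq, ih, PMF.map_bind, PMF.bind_map]
    cases m with
    | zero =>
      rw [show p 0 _ = PMF.pure (Sum.inr s) from rfl, PMF.pure_bind, PMF.pure_bind]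
      exact map_elim_phaseOneStep F (T 0) v ⟨0, h⟩ s
    | succ m =>
      congr 1
      funext o
      rcases o with j | a
      · simp only [next, Function.comp_apply, Sum.elim_inl, screen, PMF.pure_map]
        split_ifs
        · rfl
        · rw [Sum.elim_inr, phaseOneStep_false F m.succ_ne_zero, PMF.pure_map, Option.elim_some]
      · exact map_elim_phaseOneStep F (T 0) v ⟨m + 1, h⟩ a

theorem twoPhase_roundLaw_inl {t : ℕ} (ht : t < phaseOneRounds n) (s : Bool) (S : Set ℝ≥0) :
    ((twoPhase F T ε).roundLaw F t s).toOuterMeasure (Sum.inl '' S) =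
      1 / n * F.maxLaw.toOuterMeasure (S ∩ {x | T 0 < x}) := by
  classical
  rw [← tsum_law_mul_activeProb, ← ENNReal.tsum_mul_left]
  have hroundLaw := OnlineAlgorithm.toOuterMeasure_roundLaw_inl (A := twoPhase F T ε) (F := F) t s S
  refine hroundLaw.trans (tsum_congr fun v => ?_)
  rw [mul_left_comm, Finset.mul_sum _ _ (1 / (n : ℝ≥0∞))]
  refine congrArg (F.law v * ·) (Finset.sum_congr rfl fun i _ => ?_)
  have hblock : (twoPhase F T ε).runBlock t v s (Sum.inl i) =
      if T 0 < v i then 1 / n * (activeProb F v i : ℝ≥0∞) else 0 := by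
    refine (DFunLike.congr_fun (twoPhase_runPrefix_of_lt F T ht v s le_rfl) (Sum.inl i)).trans ?_
    exact (map_screen_inl (T 0) v ((ocrs F).runBlock t v s) i).trans
      (congrArg (fun p : ℝ≥0∞ => if T 0 < v i then p else 0) (ocrs_runBlock_inl F t s v i))
  refine (congrArg (S.indicator 1 (v i) * ·) hblock).trans ?_
  by_cases hS : v i ∈ S <;> by_cases hT : T 0 < v i <;> simp [hS, hT]

theorem le_of_none_mem_support_phaseOneStep {T₀ : ℝ} {i : Fin n} {x : Fin (i.val + 1) → ℝ≥0}
    {a : Bool} (h : none ∈ (phaseOneStep F T₀ i x a).support) : T₀ ≤ x (Fin.last i) := by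
  rw [phaseOneStep, PMF.mem_support_map_iff] at h
  obtain ⟨d, -, hd⟩ := h
  grind

theorem none_mem_support_thresholdStep {m : ℕ} {T₀ : ℝ} {x : Fin (m + 1) → ℝ≥0} {a : Bool} :
    none ∈ (thresholdStep T₀ x a).support ↔ T₀ ≤ x (Fin.last m) := by
  rw [thresholdStep]
  split_ifs with h <;> simp [h]

theorem some_mem_support_thresholdStep {m : ℕ} {T₀ : ℝ} {x : Fin (m + 1) → ℝ≥0} {a b : Bool} :
    some b ∈ (thresholdStep T₀ x a).support ↔ b = a ∧ x (Fin.last m) < T₀ := by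
  rw [thresholdStep]
  split_ifs with h <;> simp [h, lt_of_not_ge]

theorem le_of_none_mem_support_step {t : ℕ} {i : Fin n} {x : Fin (i.val + 1) → ℝ≥0} {a : Bool}
    (h : none ∈ ((twoPhase F T ε).step t i x a).support) :
    T (t - phaseOneRounds n - 1) ≤ x (Fin.last i) := by
  simp only [twoPhase] at h
  split_ifs at h with h₁ h₂
  · rw [Nat.sub_eq_zero_of_le h₁.le, Nat.zero_sub]
    exact le_of_none_mem_support_phaseOneStep F h
  · exact none_mem_support_thresholdStep.1 h
  · exact absurd ((PMF.mem_support_pure_iff _ _).1 h) nofun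

theorem lt_of_some_mem_support_step {t : ℕ} (h₁ : phaseOneRounds n ≤ t)
    (h₂ : t < phaseOneRounds n + phaseTwoRounds n ε) {i : Fin n} {x : Fin (i.val + 1) → ℝ≥0}
    {a b : Bool} (h : some b ∈ ((twoPhase F T ε).step t i x a).support) :
    x (Fin.last i) < T (t - phaseOneRounds n - 1) := by
  simp only [twoPhase, if_neg h₁.not_gt, if_pos h₂] at h
  exact (some_mem_support_thresholdStep.1 h).2

end Rounds

section DistributionFunctions

variable (D : PMF ℝ≥0) {y z : ℝ}

theorem prLT_eq_toReal_toOuterMeasure (y : ℝ) :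
    prLT D y = (D.toOuterMeasure {x | x < y}).toReal := by
  rw [prLT, MeasureTheory.measureReal_def, PMF.toMeasure_apply_eq_toOuterMeasure]

theorem prGE_eq_toReal_toOuterMeasure (y : ℝ) :
    prGE D y = (D.toOuterMeasure {x | y ≤ x}).toReal := by
  rw [prGE, MeasureTheory.measureReal_def, PMF.toMeasure_apply_eq_toOuterMeasure]

theorem toReal_toOuterMeasure_lt_eq_one_sub_prLE (y : ℝ) :
    (D.toOuterMeasure {x | y < x}).toReal = 1 - prLE D y := by
  rw [prLE,
    ← MeasureTheory.probReal_compl_eq_one_sub (measurableSet_le (by fun_prop) (by fun_prop)),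
    ← PMF.toMeasure_apply_eq_toOuterMeasure, ← MeasureTheory.measureReal_def]
  congr 1 with x
  simp

theorem prGE_eq_one_sub_prLT (y : ℝ) : prGE D y = 1 - prLT D y := by
  rw [prGE, prLT,
    ← MeasureTheory.probReal_compl_eq_one_sub (measurableSet_lt (by fun_prop) (by fun_prop))]
  congr 1 with x
  simp

theorem prLT_nonneg (y : ℝ) : 0 ≤ prLT D y := MeasureTheory.measureReal_nonneg

theorem prLT_le_one (y : ℝ) : prLT D y ≤ 1 := MeasureTheory.measureReal_le_one

theorem prLT_mono (h : y ≤ z) : prLT D y ≤ prLT D z :=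
  MeasureTheory.measureReal_mono fun _ hx => lt_of_lt_of_le hx h

theorem prLE_le_prLT (h : y < z) : prLE D y ≤ prLT D z :=
  MeasureTheory.measureReal_mono fun _ hx => lt_of_le_of_lt hx h

variable {D} in
theorem IsQuantile.toOuterMeasure_lt_le {q t : ℝ} (h : IsQuantile D q t) :
    D.toOuterMeasure {x | t < x} ≤ ENNReal.ofReal (1 - q) := by
  rw [← ENNReal.ofReal_toReal (toOuterMeasure_ne_top _ _), toReal_toOuterMeasure_lt_eq_one_sub_prLE]
  exact ENNReal.ofReal_le_ofReal (sub_le_sub_left h.2 1)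

end DistributionFunctions

theorem le_sum_range_one_sub_pow {x : ℝ} (hx : x ≤ 2) (m : ℕ) :
    m - m * (m - 1) / 2 * x ≤ ∑ i ∈ Finset.range m, (1 - x) ^ i := by
  induction m with
  | zero => simp
  | succ m ih =>
    have hbernoulli : 1 + m * -x ≤ (1 + -x) ^ m := one_add_mul_le_pow (by linarith) m
    rw [← sub_eq_add_neg] at hbernoulli
    rw [Finset.sum_range_succ]
    push_cast
    linarith

theorem natCast_le_sum_range_one_sub_inv_sq_pow {n : ℕ} (hn : 0 < n) :
    (n : ℝ≥0∞) ≤ ∑ i ∈ Finset.range (n + 1), (1 - 1 / (n : ℝ≥0∞) * (1 / n)) ^ i := by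
  have hn₁ : (1 : ℝ) ≤ n := by exact_mod_cast hn
  have hx : 1 / (n : ℝ) * (1 / n) ≤ 1 := mul_le_one₀
    ((div_le_one (by positivity)).2 hn₁) (by positivity) ((div_le_one (by positivity)).2 hn₁)
  have hsum : (n : ℝ) ≤ ∑ i ∈ Finset.range (n + 1), (1 - 1 / (n : ℝ) * (1 / n)) ^ i := by
    refine le_trans ?_ (le_sum_range_one_sub_pow (by linarith) (n + 1))
    push_cast
    field_simp
    nlinarith
  have hcast : 1 - 1 / (n : ℝ≥0∞) * (1 / n) = ENNReal.ofReal (1 - 1 / (n : ℝ) * (1 / n)) := by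
    rw [ENNReal.ofReal_sub _ (by positivity), ENNReal.ofReal_mul (by positivity),
      ENNReal.ofReal_div_of_pos (by positivity), ENNReal.ofReal_one, ENNReal.ofReal_natCast]
  rw [hcast, ← ENNReal.ofReal_natCast]
  simp only [← ENNReal.ofReal_pow (sub_nonneg.2 hx)]
  rw [← ENNReal.ofReal_sum_of_nonneg fun i _ => pow_nonneg (sub_nonneg.2 hx) i]
  exact ENNReal.ofReal_le_ofReal hsum

section Domination

variable {n : ℕ} {F : Instance n} {T : ℕ → ℝ} {ε : ℝ} {k : ℕ} {y : ℝ}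

theorem Instance.toOuterMeasure_law_forall_lt (F : Instance n) (y : ℝ) :
    F.law.toOuterMeasure {v | ∀ i, (v i : ℝ) < y} = F.maxLaw.toOuterMeasure {x | x < y} := by
  rw [Instance.maxLaw, PMF.toOuterMeasure_map_apply]
  congr 1 with v
  have : Nonempty (Fin n) := Fin.pos_iff_nonempty.1 F.pos
  obtain ⟨i, -, hi⟩ := Finset.exists_mem_eq_sup Finset.univ Finset.univ_nonempty v
  simp only [Set.mem_ofPred_eq, Set.mem_preimage]
  refine ⟨fun h => hi ▸ h i, fun h j => lt_of_le_of_lt ?_ h⟩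
  exact_mod_cast Finset.le_sup (Finset.mem_univ j)

theorem toOuterMeasure_value_lt_le_prod (T : ℕ → ℝ) {c : ℕ} (hc : c ≤ phaseTwoRounds n ε)
    (hk : phaseOneRounds n + c ≤ k)
    (hy : ∀ u < phaseOneRounds n + c, y ≤ T (u - phaseOneRounds n - 1)) :
    ((twoPhase F T ε).value F k).toOuterMeasure {x | x < y} ≤
      ∏ w ∈ Finset.range c, F.maxLaw.toOuterMeasure {x | x < T (w - 1)} := by
  have hprod := OnlineAlgorithm.valueFrom_le_prod (A := twoPhase F T ε) (F := F) (t := 0)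
    (S := {x | x < y})
    (c := fun u => if u < phaseOneRounds n then 1 else
      F.maxLaw.toOuterMeasure {x | x < T (u - phaseOneRounds n - 1)}) hk
    (fun u hu s => ?_) (fun u hu s => ?_) (twoPhase F T ε).init
  · rw [Finset.prod_range_add, Finset.prod_eq_one, one_mul] at hprod
    · simp only [Nat.add_sub_cancel_left, add_lt_iff_neg_left, not_lt_zero, if_false] at hprod
      exact hprod
    · intro u hu
      exact if_pos (Finset.mem_range.1 hu)
  · rw [zero_add]
    exact OnlineAlgorithm.toOuterMeasure_roundLaw_inl_eq_zero
      (fun i x a h =>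
        ((hy u hu).trans (le_of_none_mem_support_step F T h)).not_gt) s
  · rw [zero_add]
    split_ifs with hu₁
    · exact toOuterMeasure_le_one _ _
    · rw [← F.toOuterMeasure_law_forall_lt]
      exact OnlineAlgorithm.toOuterMeasure_roundLaw_range_inr_le (S := {x | x < T _})
        (fun i x a b h => lt_of_some_mem_support_step F T (not_lt.1 hu₁) (by omega) h) s

theorem prLT_value_le_prod (T : ℕ → ℝ) {c : ℕ} (hc : c ≤ phaseTwoRounds n ε)
    (hk : phaseOneRounds n + c ≤ k)
    (hy : ∀ u < phaseOneRounds n + c, y ≤ T (u - phaseOneRounds n - 1)) :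
    prLT ((twoPhase F T ε).value F k) y ≤
      ∏ w ∈ Finset.range c, prLT F.maxLaw (T (w - 1)) := by
  simp only [prLT_eq_toReal_toOuterMeasure, ← ENNReal.toReal_prod]
  exact ENNReal.toReal_mono (ENNReal.prod_ne_top fun _ _ => toOuterMeasure_ne_top _ _)
    (toOuterMeasure_value_lt_le_prod T hc hk hy)

theorem prod_prLT_le (hT : IsThresholdSeq F T) (j : ℕ) :
    ∏ w ∈ Finset.range (j + 2), prLT F.maxLaw (T (w - 1)) ≤
      prLT F.maxLaw (T 0) ^ 2 ^ (j + 1) := by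
  induction j with
  | zero => simp [Finset.prod_range_succ, pow_two]
  | succ j ih =>
    rw [Finset.prod_range_succ, pow_succ 2 (j + 1), mul_two, pow_add]
    exact mul_le_mul ih (hT.pos (j + 1) (by omega)).1 (prLT_nonneg _ _)
      (pow_nonneg (prLT_nonneg _ _) _)

theorem prLT_value_le_of_le (hT : IsThresholdSeq F T) {r : ℕ} (hr : r + 2 ≤ phaseTwoRounds n ε)
    (hk : phaseOneRounds n + phaseTwoRounds n ε ≤ k) (hy₀ : y ≤ T 0) (hy : T r ≤ y) :
    prLT ((twoPhase F T ε).value F k) y ≤ prLT F.maxLaw y := by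
  classical
  by_cases hlt : ∃ i ≤ r, T i < y
  · obtain ⟨hir, hi⟩ := Nat.find_spec hlt
    obtain ⟨j, hj⟩ : ∃ j, Nat.find hlt = j + 1 :=
      Nat.exists_eq_succ_of_ne_zero fun h₀ => (h₀ ▸ hi).not_ge hy₀
    have hmin (i : ℕ) (hij : i ≤ j) : y ≤ T i := by
      by_contra! h
      exact Nat.find_min hlt (m := i) (by omega) ⟨by omega, h⟩
    calc prLT ((twoPhase F T ε).value F k) y
        ≤ ∏ w ∈ Finset.range (j + 2), prLT F.maxLaw (T (w - 1)) :=
          prLT_value_le_prod T (by omega) (by omega) fun u hu => hmin _ (by omega)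
      _ ≤ prLT F.maxLaw (T 0) ^ 2 ^ (j + 1) := prod_prLT_le hT j
      _ ≤ prLE F.maxLaw (T (j + 1)) := (hT.pos (j + 1) (by omega)).2
      _ ≤ prLT F.maxLaw y := prLE_le_prLT _ (hj ▸ hi)
  · push Not at hlt
    calc prLT ((twoPhase F T ε).value F k) y
        ≤ ∏ w ∈ Finset.range (r + 2), prLT F.maxLaw (T (w - 1)) :=
          prLT_value_le_prod T hr (by omega) fun u hu => hlt _ (by omega)
      _ = (∏ w ∈ Finset.range (r + 1), prLT F.maxLaw (T (w - 1))) * prLT F.maxLaw (T r) :=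
          Finset.prod_range_succ _ _
      _ ≤ prLT F.maxLaw (T r) := mul_le_of_le_one_left (prLT_nonneg _ _)
          (Finset.prod_le_one (fun _ _ => prLT_nonneg _ _) fun _ _ => prLT_le_one _ _)
      _ ≤ prLT F.maxLaw y := prLT_mono _ hy

theorem toOuterMeasure_le_value_of_lt (hT : IsThresholdSeq F T) (hk : phaseOneRounds n ≤ k)
    (hy : T 0 < y) : F.maxLaw.toOuterMeasure {x | y ≤ x} ≤
      ((twoPhase F T ε).value F k).toOuterMeasure {x | y ≤ x} := by
  have hn : (n : ℝ≥0∞) ≠ 0 := by exact_mod_cast F.pos.ne'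
  set a := F.maxLaw.toOuterMeasure {x | y ≤ x}
  calc a = 1 / n * a * n := by
        rw [mul_right_comm, one_div, ENNReal.inv_mul_cancel hn (ENNReal.natCast_ne_top n), one_mul]
    _ ≤ 1 / n * a * ∑ i ∈ Finset.range (phaseOneRounds n), (1 - 1 / (n : ℝ≥0∞) * (1 / n)) ^ i := by
        gcongr
        exact natCast_le_sum_range_one_sub_inv_sq_pow F.pos
    _ ≤ ((twoPhase F T ε).value F k).toOuterMeasure {x | y ≤ x} := by
        refine OnlineAlgorithm.mul_geom_sum_le_valueFrom (A := twoPhase F T ε) (F := F) (t := 0)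
          hk (fun u hu s => ?_) (fun u hu s => ?_) (twoPhase F T ε).init
        · rw [zero_add, twoPhase_roundLaw_inl F T hu s]
          gcongr
          exact F.maxLaw.toOuterMeasure.mono fun x hx => ⟨hx, lt_of_lt_of_le hy hx⟩
        · rw [zero_add, ← Set.image_univ, twoPhase_roundLaw_inl F T hu s, Set.univ_inter]
          gcongr
          refine hT.zero.toOuterMeasure_lt_le.trans_eq ?_
          rw [sub_sub_cancel, ENNReal.ofReal_div_of_pos (by exact_mod_cast F.pos),
            ENNReal.ofReal_one, ENNReal.ofReal_natCast]

theorem prGE_le_prGE_value (hT : IsThresholdSeq F T) {r : ℕ} (hr : r + 2 ≤ phaseTwoRounds n ε)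
    (hk : phaseOneRounds n + phaseTwoRounds n ε ≤ k) (y : ℝ) (hy : T r ≤ y) :
    prGE F.maxLaw y ≤ prGE ((twoPhase F T ε).value F k) y := by
  rcases le_or_gt y (T 0) with h | h
  · simp only [prGE_eq_one_sub_prLT]
    exact sub_le_sub_left (prLT_value_le_of_le hT hr hk h hy) 1
  · simp only [prGE_eq_toReal_toOuterMeasure]
    exact ENNReal.toReal_mono (toOuterMeasure_ne_top _ _)
      (toOuterMeasure_le_value_of_lt hT (by omega) h)

end Domination

section Thresholds

theorem exists_leftLim_le_and_le (f : StieltjesFunction ℝ) {q : ℝ} (hlt : ∃ t, f t < q)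
    (hle : ∃ t, q ≤ f t) : ∃ t, Function.leftLim f t ≤ q ∧ q ≤ f t := by
  obtain ⟨b, hb⟩ := hlt
  have hbdd : BddBelow {t | q ≤ f t} :=
    ⟨b, fun t ht => le_of_not_gt fun h => (hb.trans_le ht).not_ge (f.mono h.le)⟩
  refine ⟨sInf {t | q ≤ f t}, ?_, ?_⟩
  · refine le_of_tendsto (f.mono.tendsto_leftLim _) ?_
    filter_upwards [self_mem_nhdsWithin] with s hs
    exact le_of_not_ge fun h => (csInf_le hbdd h).not_gt hs
  · refine ge_of_tendsto ((f.right_continuous _).mono Set.Ioi_subset_Ici_self) ?_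
    filter_upwards [self_mem_nhdsWithin] with s hs
    obtain ⟨t, ht, hts⟩ := exists_lt_of_csInf_lt hle hs
    exact le_trans ht (f.mono hts.le)

theorem exists_measureReal_Iio_le_and_le_measureReal_Iic (μ : MeasureTheory.Measure ℝ)
    [MeasureTheory.IsProbabilityMeasure μ] {q : ℝ} (h₀ : 0 < q) (h₁ : q < 1) :
    ∃ t, μ.real (Set.Iio t) ≤ q ∧ q ≤ μ.real (Set.Iic t) := by
  obtain ⟨t, hlt, hle⟩ := exists_leftLim_le_and_le (ProbabilityTheory.cdf μ)
    ((ProbabilityTheory.tendsto_cdf_atBot μ).eventually_lt_const h₀).exists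
    ((ProbabilityTheory.tendsto_cdf_atTop μ).eventually_const_le h₁).exists
  refine ⟨t, ?_, by rwa [← ProbabilityTheory.cdf_eq_real]⟩
  rw [MeasureTheory.measureReal_def, ← ProbabilityTheory.measure_cdf μ,
    StieltjesFunction.measure_Iio _ (ProbabilityTheory.tendsto_cdf_atBot μ), sub_zero]
  exact ENNReal.toReal_le_of_le_ofReal h₀.le (ENNReal.ofReal_le_ofReal hlt)

theorem exists_isQuantile (D : PMF ℝ≥0) {q : ℝ} (h₀ : 0 ≤ q) (h₁ : q < 1) :
    ∃ t, IsQuantile D q t := by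
  rcases h₀.eq_or_lt with rfl | h₀
  · exact ⟨0, by simp [prLT], MeasureTheory.measureReal_nonneg⟩
  · have : MeasureTheory.IsProbabilityMeasure (D.toMeasure.map ((↑) : ℝ≥0 → ℝ)) :=
      MeasureTheory.Measure.isProbabilityMeasure_map (by fun_prop)
    obtain ⟨t, ht⟩ := exists_measureReal_Iio_le_and_le_measureReal_Iic
      (D.toMeasure.map ((↑) : ℝ≥0 → ℝ)) h₀ h₁
    rw [MeasureTheory.map_measureReal_apply (by fun_prop) measurableSet_Iio,
      MeasureTheory.map_measureReal_apply (by fun_prop) measurableSet_Iic] at ht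
    exact ⟨t, ht⟩

variable {n : ℕ}

theorem exists_isThresholdSeq (F : Instance n) : ∃ T : ℕ → ℝ, IsThresholdSeq F T := by
  have hn : (1 : ℝ) ≤ n := by exact_mod_cast F.pos
  have hinv : 0 < 1 / (n : ℝ) := by positivity
  obtain ⟨T₀, hT₀⟩ := exists_isQuantile F.maxLaw
    (sub_nonneg.2 ((div_le_one (by positivity)).2 hn)) (sub_lt_self 1 hinv)
  have hp : prLT F.maxLaw T₀ < 1 := hT₀.1.trans_lt (sub_lt_self 1 hinv)
  choose T hT using fun i : ℕ => exists_isQuantile F.maxLaw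
    (pow_nonneg (prLT_nonneg F.maxLaw T₀) (2 ^ i))
    (pow_lt_one₀ (prLT_nonneg F.maxLaw T₀) hp (by positivity))
  refine ⟨fun i => if i = 0 then T₀ else T i, by simpa using hT₀, fun i hi => ?_⟩
  simpa [Nat.one_le_iff_ne_zero.1 hi] using hT i

theorem logb_inv_mul_le_two_pow {ε : ℝ} (hn : 0 < n) (h₀ : 0 < ε) (h₁ : ε < 1) {r : ℕ}
    (hr : rExp n ε ≤ r) : Real.logb 2 (1 / ε) * n ≤ 2 ^ r := by
  have hlog : 0 < Real.logb 2 (1 / ε) := Real.logb_pos one_lt_two (one_lt_one_div h₀ h₁)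
  have hsum : Real.logb 2 (Real.logb 2 (1 / ε)) + Real.logb 2 n ≤ (r : ℝ) :=
    Int.ceil_le.1 hr
  rw [← Real.logb_mul hlog.ne' (by positivity), Real.logb_le_iff_le_rpow one_lt_two
    (by positivity)] at hsum
  exact_mod_cast hsum

theorem one_sub_inv_pow_two_pow_le {ε : ℝ} (hn : 0 < n) (h₀ : 0 < ε) (h₁ : ε < 1) {r : ℕ}
    (hr : rExp n ε ≤ r) : (1 - 1 / (n : ℝ)) ^ 2 ^ r ≤ ε := by
  have hn₁ : (1 : ℝ) ≤ n := by exact_mod_cast hn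
  have hexp : 1 - 1 / (n : ℝ) ≤ Real.exp (-(1 / n)) := by
    linarith [Real.add_one_le_exp (-(1 / (n : ℝ)))]
  have hlog : -Real.log ε ≤ Real.logb 2 (1 / ε) := by
    rw [← Real.log_inv, ← one_div, Real.logb, le_div_iff₀ (Real.log_pos one_lt_two)]
    exact mul_le_of_le_one_right (Real.log_nonneg (one_lt_one_div h₀ h₁).le)
      (by linarith [Real.log_two_lt_d9])
  have hpow : Real.logb 2 (1 / ε) ≤ 2 ^ r / n :=
    (le_div_iff₀ (by positivity)).2 (logb_inv_mul_le_two_pow hn h₀ h₁ hr)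
  calc (1 - 1 / (n : ℝ)) ^ 2 ^ r ≤ Real.exp (-(1 / n)) ^ 2 ^ r :=
        pow_le_pow_left₀ (sub_nonneg.2 ((div_le_one (by positivity)).2 hn₁)) hexp _
    _ = Real.exp (-(2 ^ r / n)) := by
        rw [← Real.exp_nat_mul]
        congr 1
        push_cast
        ring
    _ ≤ Real.exp (Real.log ε) := Real.exp_le_exp.2 (by linarith)
    _ = ε := Real.exp_log h₀

theorem prLT_threshold_le {F : Instance n} {T : ℕ → ℝ} (hT : IsThresholdSeq F T) {ε : ℝ}
    (h₀ : 0 < ε) (h₁ : ε < 1) {r : ℕ} (hr : rExp n ε ≤ r) : prLT F.maxLaw (T r) ≤ ε := by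
  have hpow : prLT F.maxLaw (T r) ≤ prLT F.maxLaw (T 0) ^ 2 ^ r := by
    rcases Nat.eq_zero_or_pos r with rfl | hpos
    · simp
    · exact (hT.pos r hpos).1
  calc prLT F.maxLaw (T r) ≤ prLT F.maxLaw (T 0) ^ 2 ^ r := hpow
    _ ≤ (1 - 1 / (n : ℝ)) ^ 2 ^ r := pow_le_pow_left₀ (prLT_nonneg _ _) hT.zero.1 _
    _ ≤ ε := one_sub_inv_pow_two_pow_le F.pos h₀ h₁ hr

end Thresholds

section CompetitionComplexity

theorem expect_eq_lintegral_prGE (D : PMF ℝ≥0) :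
    expect D = ∫⁻ y in Set.Ioi (0 : ℝ), ENNReal.ofReal (prGE D y) := by
  have hlayer := MeasureTheory.lintegral_eq_lintegral_meas_le D.toMeasure
    (f := fun x : ℝ≥0 => (x : ℝ)) (Filter.Eventually.of_forall fun x => x.coe_nonneg)
    (by fun_prop)
  simp only [ENNReal.ofReal_coe_nnreal] at hlayer
  rw [expect, hlayer]
  exact MeasureTheory.lintegral_congr fun y => by rw [prGE, MeasureTheory.ofReal_measureReal]

variable {D₁ D₂ : PMF ℝ≥0} {ε t : ℝ}

theorem one_sub_mul_prGE_le (h₀ : 0 ≤ ε) (h₁ : ε ≤ 1) (ht : prLT D₂ t ≤ ε)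
    (hdom : ∀ y, t ≤ y → prGE D₂ y ≤ prGE D₁ y) (y : ℝ) :
    (1 - ε) * prGE D₂ y ≤ prGE D₁ y := by
  rcases le_total t y with hy | hy
  · exact (mul_le_of_le_one_left MeasureTheory.measureReal_nonneg (by linarith)).trans (hdom y hy)
  · calc (1 - ε) * prGE D₂ y ≤ 1 - ε :=
          mul_le_of_le_one_right (sub_nonneg.2 h₁) MeasureTheory.measureReal_le_one
      _ ≤ prGE D₂ t := by rw [prGE_eq_one_sub_prLT]; linarith
      _ ≤ prGE D₁ t := hdom t le_rfl
      _ ≤ prGE D₁ y := MeasureTheory.measureReal_mono fun _ hx => hy.trans hx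

theorem ofReal_one_sub_mul_expect_le (h₀ : 0 ≤ ε) (h₁ : ε ≤ 1) (ht : prLT D₂ t ≤ ε)
    (hdom : ∀ y, t ≤ y → prGE D₂ y ≤ prGE D₁ y) :
    ENNReal.ofReal (1 - ε) * expect D₂ ≤ expect D₁ := by
  rw [expect_eq_lintegral_prGE, expect_eq_lintegral_prGE,
    ← MeasureTheory.lintegral_const_mul' _ _ ENNReal.ofReal_ne_top]
  refine MeasureTheory.lintegral_mono fun y => ?_
  rw [← ENNReal.ofReal_mul (sub_nonneg.2 h₁)]
  exact ENNReal.ofReal_le_ofReal (one_sub_mul_prGE_le h₀ h₁ ht hdom y)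

theorem dominatesUpTo_of_forall_ge (ht : prLT D₂ t ≤ ε)
    (hdom : ∀ y, t ≤ y → prGE D₂ y ≤ prGE D₁ y) : DominatesUpTo ε D₁ D₂ := fun y =>
  (le_total t y).imp (hdom y) fun hy => (prLT_mono D₂ hy).trans ht

variable {n : ℕ}

theorem phaseOneRounds_add_phaseTwoRounds (hr : 0 ≤ rExp n ε) :
    ((phaseOneRounds n + phaseTwoRounds n ε : ℕ) : ℤ) = n + rExp n ε + 3 := by
  rw [phaseOneRounds, phaseTwoRounds]
  omega

theorem toNat_rExp_add_two (hr : 0 ≤ rExp n ε) : (rExp n ε).toNat + 2 = phaseTwoRounds n ε := by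
  rw [phaseTwoRounds]
  omega

theorem competitionComplexity_twoPhase_le (h₀ : 0 < ε) (h₁ : ε < 1) (hr : 0 ≤ rExp n ε)
    {τ : Instance n → ℕ → ℝ} (hτ : ∀ F, IsThresholdSeq F (τ F)) :
    competitionComplexity (fun _ F => twoPhase F (τ F) ε) ε ≤
      ((phaseOneRounds n + phaseTwoRounds n ε : ℕ) : ℕ∞) :=
  sInf_le ⟨_, ⟨Nat.add_pos_left n.succ_pos _, fun F _ hk =>
    ofReal_one_sub_mul_expect_le h₀.le h₁.le
      (prLT_threshold_le (hτ F) h₀ h₁ (Int.self_le_toNat _))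
      (prGE_le_prGE_value (hτ F) (toNat_rExp_add_two hr).le hk)⟩, rfl⟩

theorem exists_logb_le_mul_add {b c : ℝ} (hb : 1 < b) (hc : 0 < c) :
    ∃ C : ℝ, ∀ x : ℝ, 0 < x → Real.logb b x ≤ c * x + C := by
  have hlog : 0 < Real.log b := Real.log_pos hb
  refine ⟨-Real.log (c * Real.log b) / Real.log b, fun x hx => ?_⟩
  have htangent := Real.log_le_sub_one_of_pos (show 0 < c * Real.log b * x by positivity)
  rw [Real.log_mul (by positivity) hx.ne'] at htangent
  rw [Real.logb, div_le_iff₀ hlog, add_mul, div_mul_cancel₀ _ hlog.ne']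
  linarith

theorem exists_add_rExp_le {δ : ℝ} (hδ : 0 < δ) : ∃ M : ℝ, ∀ (n : ℕ) (ε : ℝ), 1 ≤ n →
    0 ≤ rExp n ε → M ≤ n + Real.logb 2 (Real.logb 2 (1 / ε)) →
    (n : ℝ) + rExp n ε + 3 ≤ (1 + δ) * (n + Real.logb 2 (Real.logb 2 (1 / ε))) := by
  obtain ⟨C₁, hC₁⟩ := exists_logb_le_mul_add one_lt_two (c := 1 / 2) (by norm_num)
  obtain ⟨C₂, hC₂⟩ := exists_logb_le_mul_add one_lt_two (c := δ / 4) (by positivity)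
  refine ⟨2 / δ * (δ / 4 * (2 * (1 + C₁)) + C₂ + 4), fun n ε hn hr hM => ?_⟩
  have hn' : (0 : ℝ) < n := by exact_mod_cast hn
  set L := Real.logb 2 (Real.logb 2 (1 / ε))
  have hceil : (rExp n ε : ℝ) < L + Real.logb 2 n + 1 := Int.ceil_lt_add_one _
  have hr' : (0 : ℝ) ≤ rExp n ε := by exact_mod_cast hr
  -- As `r ≥ 0`, `L` cannot drop far below `-log n`, hence `n = O(n + L)`.
  have hnL : (n : ℝ) ≤ 2 * (n + L) + 2 * (1 + C₁) := by linarith [hC₁ n hn']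
  have hlog : Real.logb 2 n ≤ δ / 4 * (2 * (n + L) + 2 * (1 + C₁)) + C₂ :=
    (hC₂ n hn').trans (by gcongr)
  have hconst : δ / 4 * (2 * (1 + C₁)) + C₂ + 4 ≤ δ / 2 * (n + L) := by
    rw [← div_le_iff₀' (by positivity)]
    exact le_of_eq_of_le (by field_simp) hM
  linarith

theorem exists_rounds_le {δ : ℝ} (hδ : 0 < δ) : ∃ M : ℝ, ∀ (n : ℕ) (ε : ℝ), 1 ≤ n →
    0 ≤ rExp n ε → M ≤ n + Real.logb 2 (Real.logb 2 (1 / ε)) →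
    ((phaseOneRounds n + phaseTwoRounds n ε : ℕ) : ℝ) ≤
      (1 + δ) * (n + Real.logb 2 (Real.logb 2 (1 / ε))) := by
  obtain ⟨M, hM⟩ := exists_add_rExp_le hδ
  refine ⟨M, fun n ε hn hr hMn => le_trans (le_of_eq ?_) (hM n ε hn hr hMn)⟩
  exact_mod_cast phaseOneRounds_add_phaseTwoRounds hr

end CompetitionComplexity

end CorrProphet

end

open CorrProphet in
theorem theorem1 :
    -- the algorithm is well defined, and its contention resolution scheme has selectability `1/n`
    (∀ (n : ℕ) (F : Instance n),
      (∃ T : ℕ → ℝ, IsThresholdSeq F T) ∧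
      ∀ (t : ℕ) (s : (ocrs F).State) (v : Fin n → NNReal) (i : Fin n),
        (ocrs F).runBlock t v s (Sum.inl i) =
          (1 / (n : ENNReal)) * (probMax F i.isLt (Fin.take (i.val + 1) i.isLt v) : ENNReal)) ∧
    -- it uses `n + r + 3` rounds, its value dominates the maximum down to `T r`, which is at most
    -- the `ε`-quantile, and its competition complexity is at most `n + r + 3`
    (∀ (n : ℕ) (ε : ℝ), 1 ≤ n → 0 < ε → ε < 1 → 0 ≤ rExp n ε →
      ((phaseOneRounds n + phaseTwoRounds n ε : ℕ) : ℤ) = n + rExp n ε + 3 ∧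
      ∀ τ : Instance n → ℕ → ℝ, (∀ F, IsThresholdSeq F (τ F)) →
        (∀ (F : Instance n) (k : ℕ), phaseOneRounds n + phaseTwoRounds n ε ≤ k →
          DominatesUpTo ε ((twoPhase F (τ F) ε).value F k) F.maxLaw ∧
          prLT F.maxLaw (τ F (rExp n ε).toNat) ≤ ε ∧
          ∀ y : ℝ, τ F (rExp n ε).toNat ≤ y →
            prGE F.maxLaw y ≤ prGE ((twoPhase F (τ F) ε).value F k) y) ∧
        competitionComplexity (fun _ F => twoPhase F (τ F) ε) ε
          ≤ ((phaseOneRounds n + phaseTwoRounds n ε : ℕ) : ℕ∞)) ∧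
    -- the competition complexity is `(1 + o(1)) (n + log log (1/ε))`
    (∀ δ : ℝ, 0 < δ → ∃ M : ℝ, ∀ (n : ℕ) (ε : ℝ), 1 ≤ n → 0 < ε → ε < 1 → 0 ≤ rExp n ε →
      M ≤ n + Real.logb 2 (Real.logb 2 (1 / ε)) →
      ∀ τ : Instance n → ℕ → ℝ, (∀ F, IsThresholdSeq F (τ F)) →
        ∃ K : ℕ, competitionComplexity (fun _ F => twoPhase F (τ F) ε) ε = (K : ℕ∞) ∧
          K ≤ phaseOneRounds n + phaseTwoRounds n ε ∧
          ((phaseOneRounds n + phaseTwoRounds n ε : ℕ) : ℝ) ≤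
            (1 + δ) * (n + Real.logb 2 (Real.logb 2 (1 / ε)))) := by
  refine ⟨fun n F => ⟨exists_isThresholdSeq F, ocrs_runBlock_inl F⟩, fun n ε _ h₀ h₁ hr => ?_,
    fun δ hδ => ?_⟩
  · refine ⟨phaseOneRounds_add_phaseTwoRounds hr, fun τ hτ =>
      ⟨fun F k hk => ?_, competitionComplexity_twoPhase_le h₀ h₁ hr hτ⟩⟩
    have hquantile := prLT_threshold_le (hτ F) h₀ h₁ (Int.self_le_toNat (rExp n ε))
    have hdom := prGE_le_prGE_value (hτ F) (toNat_rExp_add_two hr).le hk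
    exact ⟨dominatesUpTo_of_forall_ge hquantile hdom, hquantile, hdom⟩
  · obtain ⟨M, hM⟩ := exists_rounds_le hδ
    refine ⟨M, fun n ε hn h₀ h₁ hr hMn τ hτ => ?_⟩
    have hle := competitionComplexity_twoPhase_le h₀ h₁ hr hτ
    obtain ⟨K, hK⟩ := ENat.ne_top_iff_exists.1 (ne_top_of_le_ne_top (ENat.natCast_ne_top _) hle)
    exact ⟨K, hK.symm, by exact_mod_cast hK.trans_le hle, hM n ε hn hr hMn⟩
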